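/- Let $Y_1,Y_2,\ldots$ be independent $\{0,1\}$-valued random variables with $p_\ell=\mathbb P(Y_\ell=1)\in(0,1)$, and suppose that $p_1,p_2,\ldots$ is periodic with period length $r\ge 1$ (the least positive integer with $p_\ell=p_{mr+\ell}$ for all $\ell,m$). Let $d\ge 3$ be an integer, $q=\lfloor (d-1)/2\rfloor$, $\omega_j=2\pi j/d$, and for $x\in\mathbb R^d$ put $$I_x(\omega_j)=\frac1d\Big|\sum_{\ell=1}^d x_\ell e^{-\mathrm i\ell\omega_j}\Big|^2,\qquad A=\{x\in\mathbb R^d: I_x(\omega_1)=\cdots=I_x(\omega_q)=0\},$$ $$g(x)=\frac{\max_{1\le j\le q}I_x(\omega_j)}{\sum_{m=1}^q I_x(\omega_m)}\quad(x\notin A),\qquad f(x)=g(x)\ \text{for } x\notin A,\quad f(x)=0\ \text{for } x\in A.$$ For $1\le i\le d$ let $$Z_i^n=\frac1{\lfloor n/d\rfloor}\sum_{k=0}^{\lfloor n/d\rfloor-1}Y_{i+kd},\qquad e_i=\frac1r\sum_{k=0}^{r-1}p_{i+kd},\qquad v_i=\frac1r\sum_{k=0}^{r-1}\operatorname{Var}(Y_{i+kd}).$$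 Let $N_1,\ldots,N_d$ be i.i.d. standard normal random variables. If $(e_1,\ldots,e_d)\in A$, then, as $n\to\infty$, $$f(Z_1^n,\ldots,Z_d^n)\ \xrightarrow{\ \mathcal L\ }\ g\big(\sqrt{v_1}\,N_1,\ldots,\sqrt{v_d}\,N_d\big)\ \overset{d}{=}\ g\Big(N_1,\sqrt{\tfrac{v_2}{v_1}}\,N_2,\ldots,\sqrt{\tfrac{v_d}{v_1}}\,N_d\Big),$$ where the arguments of $g$ in the two expressions on the right lie outside $A$ almost surely, so that these are well defined. -/

import Mathlib

open MeasureTheory ProbabilityTheory Filter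

noncomputable section

namespace BinaryPeriodicity

/-! Sequences and vectors are indexed from `0`: `Y k`, `p k` and `x i` stand for the mathematical
`Y_{k+1}`, `p_{k+1}` and `x_{i+1}`. Fourier frequencies keep their usual index `j = 1, …, q`. -/

/-- `r` is the period length of `p`: the least positive integer with `p_ℓ = p_{mr+ℓ}` for all
`ℓ, m`. -/
def IsPeriodLength (p : ℕ → ℝ) (r : ℕ) : Prop :=
  IsLeast {s : ℕ | 0 < s ∧ ∀ ℓ m : ℕ, p ℓ = p (m * s + ℓ)} r

/-- `q = ⌊(d-1)/2⌋`, the number of Fourier frequencies in use. -/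
def numFreq (d : ℕ) : ℕ := (d - 1) / 2

/-- The `j`-th Fourier frequency `ω_j = 2πj/d`. -/
def fourierFreq (d j : ℕ) : ℝ := 2 * Real.pi * j / d

/-- The periodogram `I_x(ω_j) = (1/d) |∑_{ℓ=1}^d x_ℓ exp(-iℓω_j)|²`. -/
def periodogram {d : ℕ} (x : Fin d → ℝ) (j : ℕ) : ℝ :=
  (1 / (d : ℝ)) *
    ‖∑ ℓ : Fin d, (x ℓ : ℂ) *
      Complex.exp (-Complex.I * ((ℓ : ℕ) + 1 : ℂ) * (fourierFreq d j : ℂ))‖ ^ 2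

/-- The set `A` on which all periodogram ordinates at `j = 1, …, q` vanish. -/
def zeroSet (d : ℕ) : Set (Fin d → ℝ) :=
  {x | ∀ j ∈ Finset.Icc 1 (numFreq d), periodogram x j = 0}

/-- Fisher's statistic `g(x) = max_{1≤j≤q} I_x(ω_j) / ∑_{m=1}^q I_x(ω_m)`, meaningful off `A`. -/
def fisherG {d : ℕ} (x : Fin d → ℝ) : ℝ :=
  (⨆ j : Finset.Icc 1 (numFreq d), periodogram x (j : ℕ)) /
    ∑ m ∈ Finset.Icc 1 (numFreq d), periodogram x m

/-- `f(x) = g(x) 1_{x ∉ A}`. -/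
def fisherF {d : ℕ} (x : Fin d → ℝ) : ℝ :=
  (zeroSet d)ᶜ.indicator fisherG x

/-- `Z_i^n = (1/⌊n/d⌋) ∑_{k=0}^{⌊n/d⌋-1} Y_{i+kd}`. -/
def blockMean {Ω : Type*} (Y : ℕ → Ω → ℝ) (d n : ℕ) (ω : Ω) (i : Fin d) : ℝ :=
  (1 / ((n / d : ℕ) : ℝ)) * ∑ k ∈ Finset.range (n / d), Y ((i : ℕ) + k * d) ω

/-- `e_i = (1/r) ∑_{k=0}^{r-1} p_{i+kd}`. -/
def limitMean (p : ℕ → ℝ) (r d : ℕ) (i : Fin d) : ℝ :=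
  (1 / (r : ℝ)) * ∑ k ∈ Finset.range r, p ((i : ℕ) + k * d)

/-- `v_i = (1/r) ∑_{j=0}^{r-1} Var(Y_{i+jd})`. -/
def limitVar {Ω : Type*} [MeasurableSpace Ω] (P : Measure Ω) (Y : ℕ → Ω → ℝ) (r d : ℕ)
    (i : Fin d) : ℝ :=
  (1 / (r : ℝ)) * ∑ j ∈ Finset.range r, variance (Y ((i : ℕ) + j * d)) P

end BinaryPeriodicity

end

open BinaryPeriodicity

/-!
The laws of `Y_i, Y_{i+d}, Y_{i+2d}, …` repeat with period `r`, so the sums over successive blocks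
of `r` terms of this sequence are i.i.d., and the classical central limit theorem shows that
`√⌊n/d⌋ • (blockMean Y d n - e)` converges in distribution to `(√v₁ N₁, …, √v_d N_d)`. The statistic
`f` is invariant under nonzero dilations and under translations by elements of the subspace `A`;
hence it takes the same value at this vector as at `blockMean Y d n`. It is continuous off `A`,
which the limit almost surely avoids: a linear combination of independent random variables, one of
which is atomless and has nonzero coefficient, almost surely does not vanish. The mapping theorem
concludes.
-/

open scoped Topology

namespace BinaryPeriodicity

section Grouping

variable {Ω ι κ E : Type*} [Countable ι] [Countable κ] [MeasurableSpace Ω] [MeasurableSpace E]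
  {P : Measure Ω} {X : ι × κ → Ω → E}

theorem iIndepFun_curry (hX : ∀ z, AEMeasurable (X z) P) (hind : iIndepFun X P) :
    iIndepFun (fun i ω j ↦ X (i, j) ω) P := by
  have := hind.isProbabilityMeasure
  have hprob : ∀ i j, IsProbabilityMeasure (P.map (X (i, j))) := fun i j ↦
    Measure.isProbabilityMeasure_map (hX (i, j))
  have hrow (i : ι) : P.map (fun ω j ↦ X (i, j) ω) = Measure.infinitePi fun j ↦ P.map (X (i, j)) :=
    iIndepFun.map_fun_eq_infinitePi_map₀' (fun j ↦ hX (i, j))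
      (hind.precomp (Prod.mk_right_injective i))
  rw [iIndepFun_iff_map_fun_eq_infinitePi_map₀' fun i ↦ aemeasurable_pi_lambda _ fun j ↦ hX (i, j)]
  calc P.map (fun ω i j ↦ X (i, j) ω)
      = (P.map fun ω z ↦ X z ω).map (MeasurableEquiv.curry ι κ E) := by
        rw [AEMeasurable.map_map_of_aemeasurable (MeasurableEquiv.measurable _).aemeasurable
          (aemeasurable_pi_lambda _ hX)]
        rfl
    _ = Measure.infinitePi fun i ↦ Measure.infinitePi fun j ↦ P.map (X (i, j)) := by
        rw [iIndepFun.map_fun_eq_infinitePi_map₀' hX hind]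
        exact Measure.infinitePi_map_curry fun i j ↦ P.map (X (i, j))
    _ = Measure.infinitePi fun i ↦ P.map fun ω j ↦ X (i, j) ω := by simp only [hrow]

theorem iIndepFun_sum_snd [AddCommMonoid E] [MeasurableAdd₂ E] (hX : ∀ z, AEMeasurable (X z) P)
    (hind : iIndepFun X P) (s : Finset κ) : iIndepFun (fun i ω ↦ ∑ j ∈ s, X (i, j) ω) P :=
  (iIndepFun_curry hX hind).comp (fun _ x ↦ ∑ j ∈ s, x j) fun _ ↦ by fun_prop

end Grouping

section ConvergenceInDistribution

theorem tendstoInDistribution_comp {α ι E Ω' : Type*} {Ω : ι → Type*}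
    [∀ i, MeasurableSpace (Ω i)] [MeasurableSpace Ω'] {P : ∀ i, Measure (Ω i)}
    [∀ i, IsProbabilityMeasure (P i)] {P' : Measure Ω'} [IsProbabilityMeasure P']
    [TopologicalSpace E] [MeasurableSpace E] [OpensMeasurableSpace E] {X : ∀ i, Ω i → E}
    {Z : Ω' → E} {l : Filter ι} {l' : Filter α} {u : α → ι}
    (hX : TendstoInDistribution X l Z P P') (hu : Tendsto u l' l) :
    TendstoInDistribution (fun a ↦ X (u a)) l' Z (fun a ↦ P (u a)) P' :=
  ⟨fun a ↦ hX.forall_aemeasurable (u a), hX.aemeasurable_limit, hX.tendsto.comp hu⟩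

theorem tendstoInDistribution_smul_of_tendsto {E Ω Ω' : Type*} [MeasurableSpace Ω]
    [MeasurableSpace Ω'] {P : Measure Ω} [IsProbabilityMeasure P] {P' : Measure Ω'}
    [IsProbabilityMeasure P'] [SeminormedAddCommGroup E] [NormedSpace ℝ E]
    [SecondCountableTopology E] [MeasurableSpace E] [BorelSpace E] {X : ℕ → Ω → E} {Z : Ω' → E}
    {c : ℕ → ℝ} {c₀ : ℝ} (hc : Tendsto c atTop (𝓝 c₀))
    (hX : TendstoInDistribution X atTop Z (fun _ ↦ P) P') :
    TendstoInDistribution (fun n ω ↦ c n • X n ω) atTop (fun ω ↦ c₀ • Z ω) (fun _ ↦ P) P' :=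
  hX.continuous_comp_prodMk_of_tendstoInMeasure_const (g := fun z : E × ℝ ↦ z.2 • z.1)
    (by fun_prop) (tendstoInMeasure_of_tendsto_ae (fun _ ↦ aestronglyMeasurable_const)
      (ae_of_all _ fun _ ↦ hc)) fun _ ↦ aemeasurable_const

theorem probabilityMeasure_map_fun_eq_pi {Ω ι : Type*} [Fintype ι] {E : ι → Type*}
    [MeasurableSpace Ω] [∀ i, MeasurableSpace (E i)] {P : Measure Ω} [IsProbabilityMeasure P]
    {X : (i : ι) → Ω → E i} (hX : ∀ i, AEMeasurable (X i) P) (hind : iIndepFun X P) :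
    (⟨P.map fun ω i ↦ X i ω, Measure.isProbabilityMeasure_map (aemeasurable_pi_lambda _ hX)⟩ :
      ProbabilityMeasure (∀ i, E i)) =
    ProbabilityMeasure.pi fun i ↦ ⟨P.map (X i), Measure.isProbabilityMeasure_map (hX i)⟩ :=
  Subtype.ext (hind.map_fun_eq_pi_map hX)

theorem tendstoInDistribution_pi {α ι Ω' : Type*} [Finite ι] {E : ι → Type*}
    {Ω : α → Type*} [∀ a, MeasurableSpace (Ω a)] [MeasurableSpace Ω'] [∀ i, MeasurableSpace (E i)]
    [∀ i, TopologicalSpace (E i)] [∀ i, SecondCountableTopology (E i)]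
    [∀ i, TopologicalSpace.PseudoMetrizableSpace (E i)] [∀ i, OpensMeasurableSpace (E i)]
    {P : ∀ a, Measure (Ω a)} [∀ a, IsProbabilityMeasure (P a)] {P' : Measure Ω'}
    [IsProbabilityMeasure P'] {l : Filter α} {X : ∀ a, (i : ι) → Ω a → E i} {Z : (i : ι) → Ω' → E i}
    (h : ∀ i, TendstoInDistribution (fun a ↦ X a i) l (Z i) P P')
    (hX : ∀ a, iIndepFun (X a) (P a)) (hZ : iIndepFun Z P') :
    TendstoInDistribution (fun a ω i ↦ X a i ω) l (fun ω i ↦ Z i ω) P P' where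
  forall_aemeasurable a := aemeasurable_pi_lambda _ fun i ↦ (h i).forall_aemeasurable a
  aemeasurable_limit := aemeasurable_pi_lambda _ fun i ↦ (h i).aemeasurable_limit
  tendsto := by
    cases nonempty_fintype ι
    rw [probabilityMeasure_map_fun_eq_pi (fun i ↦ (h i).aemeasurable_limit) hZ]
    have hpi := (ProbabilityMeasure.continuous_pi.tendsto _).comp
      (tendsto_pi_nhds.2 fun i ↦ (h i).tendsto)
    exact hpi.congr fun a ↦ (probabilityMeasure_map_fun_eq_pi
      (fun i ↦ (h i).forall_aemeasurable a) (hX a)).symm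

theorem tendstoInDistribution_comp_of_continuousOn
    {ι Ω' E F : Type*} {Ω : ι → Type*} [∀ i, MeasurableSpace (Ω i)] [MeasurableSpace Ω']
    {P : ∀ i, Measure (Ω i)} [∀ i, IsProbabilityMeasure (P i)]
    {P' : Measure Ω'} [IsProbabilityMeasure P'] {l : Filter ι} [l.IsCountablyGenerated]
    [TopologicalSpace E] [MeasurableSpace E] [BorelSpace E] [HasOuterApproxClosed E]
    [TopologicalSpace F] [MeasurableSpace F] [BorelSpace F] [HasOuterApproxClosed F]
    {X : ∀ i, Ω i → E} {Z : Ω' → E} {f : E → F} {U : Set E}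
    (hX : TendstoInDistribution X l Z P P') (hf : Measurable f) (hU : IsOpen U)
    (hfU : ContinuousOn f U) (hZ : ∀ᵐ ω ∂P', Z ω ∈ U) :
    TendstoInDistribution (fun i ω ↦ f (X i ω)) l (fun ω ↦ f (Z ω)) P P' where
  forall_aemeasurable i := hf.comp_aemeasurable' (hX.forall_aemeasurable i)
  aemeasurable_limit := hf.comp_aemeasurable' hX.aemeasurable_limit
  tendsto := by
    refine tendsto_of_forall_isOpen_le_liminf' fun G hG ↦ ?_
    have hV : IsOpen (U ∩ f ⁻¹' G) := hfU.isOpen_inter_preimage hU hG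
    have hlim : P'.map (fun ω ↦ f (Z ω)) G = P'.map Z (U ∩ f ⁻¹' G) := by
      rw [Measure.map_apply_of_aemeasurable (hf.comp_aemeasurable' hX.aemeasurable_limit)
        hG.measurableSet, Measure.map_apply_of_aemeasurable hX.aemeasurable_limit hV.measurableSet]
      refine measure_congr ?_
      filter_upwards [hZ] with ω hω
      exact propext ⟨fun h ↦ ⟨hω, h⟩, fun h ↦ h.2⟩
    have hle (i : ι) : (P i).map (X i) (U ∩ f ⁻¹' G) ≤ (P i).map (fun ω ↦ f (X i ω)) G := by
      rw [Measure.map_apply_of_aemeasurable (hf.comp_aemeasurable' (hX.forall_aemeasurable i))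
        hG.measurableSet, Measure.map_apply_of_aemeasurable (hX.forall_aemeasurable i)
        hV.measurableSet]
      exact measure_mono fun ω hω ↦ hω.2
    calc P'.map (fun ω ↦ f (Z ω)) G
        = P'.map Z (U ∩ f ⁻¹' G) := hlim
      _ ≤ liminf (fun i ↦ (P i).map (X i) (U ∩ f ⁻¹' G)) l :=
        ProbabilityMeasure.le_liminf_measure_open_of_tendsto hX.tendsto hV
      _ ≤ liminf (fun i ↦ (P i).map (fun ω ↦ f (X i ω)) G) l :=
        liminf_le_liminf (Eventually.of_forall hle)

end ConvergenceInDistribution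

section Blocks

/-- The sum of the `m`-th block of `r` consecutive terms of the sequence `X`, with blocks counted
from `0`; these are the i.i.d. variables to which the classical central limit theorem applies. -/
def blockSum {Ω : Type*} (X : ℕ → Ω → ℝ) (r m : ℕ) (ω : Ω) : ℝ :=
  ∑ j : Fin r, X (m * r + j) ω

theorem blockSum_zero_eq_sum_range {Ω : Type*} (X : ℕ → Ω → ℝ) (r : ℕ) :
    blockSum X r 0 = ∑ j ∈ Finset.range r, X j := by
  ext ω
  simp [blockSum, Finset.sum_range]

theorem sum_range_mul_eq_sum_blockSum {Ω : Type*} (X : ℕ → Ω → ℝ) (r n : ℕ) (ω : Ω) :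
    ∑ k ∈ Finset.range (n * r), X k ω = ∑ m ∈ Finset.range n, blockSum X r m ω := by
  induction n with
  | zero => simp
  | succ n ih =>
    rw [Nat.succ_mul, Finset.sum_range_add, ih, Finset.sum_range_succ, blockSum,
      Finset.sum_range (n := r)]

variable {Ω Ω' : Type*} [MeasurableSpace Ω] [MeasurableSpace Ω'] {P : Measure Ω} {P' : Measure Ω'}
  {X : ℕ → Ω → ℝ} {r : ℕ}

theorem identDistrib_mul_add (hper : ∀ k, IdentDistrib (X (k + r)) (X k) P P) (m k : ℕ) :
    IdentDistrib (X (m * r + k)) (X k) P P := by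
  induction m with
  | zero => simpa using IdentDistrib.refl (hper k).aemeasurable_snd
  | succ m ih => simpa only [Nat.succ_mul, add_right_comm] using (hper _).trans ih

theorem iIndepFun_blockSum [NeZero r] (hX : ∀ k, AEMeasurable (X k) P) (hind : iIndepFun X P) :
    iIndepFun (blockSum X r) P :=
  iIndepFun_sum_snd (X := fun z : ℕ × Fin r ↦ X (z.1 * r + z.2)) (fun _ ↦ hX _)
    (hind.precomp (Nat.divModEquiv r).symm.injective) Finset.univ

theorem identDistrib_blockSum (hind : iIndepFun X P)
    (hper : ∀ k, IdentDistrib (X (k + r)) (X k) P P) (m : ℕ) :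
    IdentDistrib (blockSum X r m) (blockSum X r 0) P P := by
  have hinj (m : ℕ) : Function.Injective fun j : Fin r ↦ m * r + j :=
    (add_right_injective _).comp Fin.val_injective
  exact (IdentDistrib.pi (fun j : Fin r ↦ (identDistrib_mul_add hper m j).trans
      (identDistrib_mul_add hper 0 j).symm) (hind.precomp (hinj m)) (hind.precomp (hinj 0))).comp
    (u := fun x ↦ ∑ j, x j) (by fun_prop)

theorem tendstoInDistribution_inv_sqrt_mul_sum_range_mul [IsProbabilityMeasure P]
    [IsProbabilityMeasure P'] [NeZero r] (hL2 : ∀ k, MemLp (X k) 2 P) (hind : iIndepFun X P)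
    (hper : ∀ k, IdentDistrib (X (k + r)) (X k) P P) {N : Ω' → ℝ}
    (hN : HasLaw N (gaussianReal 0 1) P') :
    TendstoInDistribution
      (fun (n : ℕ) ω ↦ (√n)⁻¹ * (∑ k ∈ Finset.range (n * r), X k ω -
        n * ∑ j ∈ Finset.range r, P[X j])) atTop
      (fun ω ↦ √(∑ j ∈ Finset.range r, Var[X j; P]) * N ω) (fun _ ↦ P) P' := by
  set v := ∑ j ∈ Finset.range r, Var[X j; P]
  have hvar : Var[blockSum X r 0; P] = v := by
    rw [blockSum_zero_eq_sum_range, IndepFun.variance_sum (fun j _ ↦ hL2 j)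
      fun i _ j _ hij ↦ hind.indepFun hij]
  have hmean : P[blockSum X r 0] = ∑ j ∈ Finset.range r, P[X j] := by
    simp_rw [blockSum_zero_eq_sum_range, Finset.sum_apply]
    exact integral_finsetSum _ fun j _ ↦ (hL2 j).integrable one_le_two
  have hlaw : HasLaw (fun ω ↦ √v * N ω) (gaussianReal 0 Var[blockSum X r 0; P].toNNReal) P' := by
    have hv0 : 0 ≤ v := Finset.sum_nonneg fun _ _ ↦ variance_nonneg _ _
    convert gaussianReal_const_mul hN √v using 2
    · simp
    · ext
      simp [hvar, hv0]
  have hclt := tendstoInDistribution_inv_sqrt_mul_sum_sub hlaw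
    (by rw [blockSum_zero_eq_sum_range]; exact memLp_finsetSum' _ fun j _ ↦ hL2 j)
    (iIndepFun_blockSum (fun k ↦ (hL2 k).aemeasurable) hind) (identDistrib_blockSum hind hper)
  simpa only [hmean, ← sum_range_mul_eq_sum_blockSum] using hclt

theorem tendstoInMeasure_mul_sum_range_mod [NeZero r] (hint : ∀ k, Integrable (X k) P)
    (hper : ∀ k, IdentDistrib (X (k + r)) (X k) P P) {c : ℕ → ℝ} (hc : Tendsto c atTop (𝓝 0)) :
    TendstoInMeasure P (fun n ω ↦ c n * ∑ j ∈ Finset.range (n % r), X (n / r * r + j) ω) atTop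
      fun _ ↦ 0 := by
  have hbound (n : ℕ) :
      eLpNorm (fun ω ↦ c n * ∑ j ∈ Finset.range (n % r), X (n / r * r + j) ω) 1 P
        ≤ ‖c n‖ₑ * ∑ j ∈ Finset.range r, eLpNorm (X j) 1 P :=
    calc eLpNorm (fun ω ↦ c n * ∑ j ∈ Finset.range (n % r), X (n / r * r + j) ω) 1 P
        = ‖c n‖ₑ * eLpNorm (∑ j ∈ Finset.range (n % r), X (n / r * r + j)) 1 P := by
          rw [← eLpNorm_const_smul]
          congr 1 with ω
          simp
      _ ≤ ‖c n‖ₑ * ∑ j ∈ Finset.range (n % r), eLpNorm (X (n / r * r + j)) 1 P := by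
          gcongr
          exact eLpNorm_sum_le (fun j _ ↦ (hint _).aestronglyMeasurable) le_rfl
      _ = ‖c n‖ₑ * ∑ j ∈ Finset.range (n % r), eLpNorm (X j) 1 P := by
          simp only [(identDistrib_mul_add hper _ _).eLpNorm_eq]
      _ ≤ ‖c n‖ₑ * ∑ j ∈ Finset.range r, eLpNorm (X j) 1 P := by
          gcongr
          exact (Nat.mod_lt n (NeZero.pos r)).le
  have hfin : ∑ j ∈ Finset.range r, eLpNorm (X j) 1 P ≠ ⊤ :=
    ENNReal.sum_ne_top.2 fun j _ ↦ (memLp_one_iff_integrable.2 (hint j)).eLpNorm_ne_top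
  refine tendstoInMeasure_of_tendsto_eLpNorm one_ne_zero (fun n ↦ ?_) aestronglyMeasurable_const ?_
  · exact (Finset.aestronglyMeasurable_fun_sum _
      fun j _ ↦ (hint _).aestronglyMeasurable).const_mul _
  · refine tendsto_of_tendsto_of_tendsto_of_le_of_le tendsto_const_nhds ?_ (fun _ ↦ zero_le)
      fun n ↦ by simpa [Pi.sub_def] using hbound n
    simpa using ENNReal.Tendsto.mul_const hc.enorm (Or.inr hfin)

theorem tendsto_inv_sqrt_mul_sqrt_div [NeZero r] :
    Tendsto (fun n : ℕ ↦ (√n)⁻¹ * √((n / r : ℕ) : ℝ)) atTop (𝓝 (√r)⁻¹) := by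
  have h := (tendsto_nat_floor_mul_div_atTop (R := ℝ) (a := (r : ℝ)⁻¹) (by positivity)).comp
    tendsto_natCast_atTop_atTop
  simp only [Function.comp_def, inv_mul_eq_div, Nat.floor_div_natCast, Nat.floor_natCast] at h
  simpa [Real.sqrt_div, div_eq_inv_mul] using h.sqrt

theorem inv_sqrt_mul_sum_range_sub_eq [NeZero r] (x : ℕ → ℝ) (s : ℝ) (n : ℕ) :
    (√n)⁻¹ * ∑ k ∈ Finset.range n, (x k - 1 / (r : ℝ) * s) =
      ((√n)⁻¹ * √(n / r : ℕ)) *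
        ((√(n / r : ℕ))⁻¹ * (∑ k ∈ Finset.range (n / r * r), x k - (n / r : ℕ) * s)) +
      (√n)⁻¹ * ∑ j ∈ Finset.range (n % r), (x (n / r * r + j) - 1 / (r : ℝ) * s) := by
  have hr : (r : ℝ) ≠ 0 := NeZero.ne _
  have hfull : ∑ k ∈ Finset.range (n / r * r), (x k - 1 / (r : ℝ) * s) =
      ∑ k ∈ Finset.range (n / r * r), x k - (n / r : ℕ) * s := by
    rw [Finset.sum_sub_distrib, Finset.sum_const, Finset.card_range, nsmul_eq_mul, Nat.cast_mul]
    field_simp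
  conv_lhs => rw [← Nat.div_add_mod' n r, Finset.sum_range_add, hfull, Nat.div_add_mod', mul_add]
  congr 1
  rcases Nat.eq_zero_or_pos (n / r) with h | h
  · simp [h]
  · field_simp

theorem tendstoInDistribution_inv_sqrt_mul_sum_sub_of_periodic [IsProbabilityMeasure P]
    [IsProbabilityMeasure P'] [NeZero r] (hL2 : ∀ k, MemLp (X k) 2 P) (hind : iIndepFun X P)
    (hper : ∀ k, IdentDistrib (X (k + r)) (X k) P P) {N : Ω' → ℝ}
    (hN : HasLaw N (gaussianReal 0 1) P') :
    TendstoInDistribution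
      (fun (n : ℕ) ω ↦ (√n)⁻¹ * ∑ k ∈ Finset.range n,
        (X k ω - 1 / (r : ℝ) * ∑ j ∈ Finset.range r, P[X j])) atTop
      (fun ω ↦ √(1 / (r : ℝ) * ∑ j ∈ Finset.range r, Var[X j; P]) * N ω) (fun _ ↦ P) P' := by
  set s := ∑ j ∈ Finset.range r, P[X j]
  have hmeas : ∀ k, AEMeasurable (X k) P := fun k ↦ (hL2 k).aemeasurable
  have hblocks := tendstoInDistribution_smul_of_tendsto (tendsto_inv_sqrt_mul_sqrt_div (r := r))
    (tendstoInDistribution_comp (u := (· / r))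
      (tendstoInDistribution_inv_sqrt_mul_sum_range_mul hL2 hind hper hN)
      (Nat.tendsto_div_const_atTop (NeZero.ne r)))
  have hrem := tendstoInMeasure_mul_sum_range_mod (X := fun k ω ↦ X k ω - 1 / (r : ℝ) * s)
    (fun k ↦ ((hL2 k).integrable one_le_two).sub (integrable_const _))
    (fun k ↦ (hper k).comp (u := fun x ↦ x - 1 / (r : ℝ) * s) (by fun_prop))
    (tendsto_inv_atTop_zero.comp (Real.tendsto_sqrt_atTop.comp tendsto_natCast_atTop_atTop))
  refine (hblocks.add_of_tendstoInMeasure_const hrem fun n ↦ ?_).congr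
    (fun n ↦ ae_of_all _ fun ω ↦ ?_) (ae_of_all _ fun ω ↦ ?_)
  · exact (Finset.aemeasurable_fun_sum _ fun j _ ↦ (hmeas _).sub_const _).const_mul _
  · exact (inv_sqrt_mul_sum_range_sub_eq (X · ω) s n).symm
  · simp [← mul_assoc]

end Blocks

section AlmostSureNonvanishing

theorem ae_ne_of_indepFun {Ω E : Type*} [MeasurableSpace Ω] [MeasurableSpace E] [MeasurableEq E]
    {P : Measure Ω} [IsFiniteMeasure P] {X Z : Ω → E}
    (hX : AEMeasurable X P) (hZ : AEMeasurable Z P) [NullSingletonClass (P.map X)]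
    (hind : IndepFun Z X P) : ∀ᵐ ω ∂P, X ω ≠ Z ω := by
  have hD : MeasurableSet {z : E × E | z.2 = z.1} :=
    measurableSet_eq_fun measurable_snd measurable_fst
  have hnull : (P.map fun ω ↦ (Z ω, X ω)) {z | z.2 = z.1} = 0 := by
    rw [hind.map_prod_eq_prod_map_map hZ hX, Measure.measure_prod_null hD]
    filter_upwards with x
    exact measure_singleton x
  rw [Measure.map_apply_of_aemeasurable (hZ.prodMk hX) hD] at hnull
  simpa [ae_iff] using hnull

theorem ae_sum_smul_ne_zero {Ω ι E : Type*} [MeasurableSpace Ω] [Fintype ι] [AddCommGroup E]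
    [Module ℝ E] {P : Measure Ω} {N : ι → Ω → ℝ} (hN : ∀ i, AEMeasurable (N i) P)
    (hind : iIndepFun N P) {a : ι → E} {i₀ : ι} [NullSingletonClass (P.map (N i₀))]
    (ha : a i₀ ≠ 0) : ∀ᵐ ω ∂P, ∑ i, N i ω • a i ≠ 0 := by
  classical
  have := hind.isProbabilityMeasure
  obtain ⟨φ, hφ⟩ : ∃ φ : Module.Dual ℝ E, φ (a i₀) = 1 :=
    Module.Projective.exists_dual_eq_one ℝ ha
  set M : ι → Ω → ℝ := fun i ω ↦ N i ω * φ (a i)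
  have hM : iIndepFun M P := hind.comp (fun i x ↦ x * φ (a i)) fun i ↦ by fun_prop
  have hM₀ : M i₀ = N i₀ := by ext ω; simp [M, hφ]
  have hrest : IndepFun (-∑ i ∈ Finset.univ.erase i₀, M i) (N i₀) P := by
    rw [← hM₀]
    exact (hM.indepFun_finsetSum_of_notMem₀ (fun i ↦ by fun_prop)
      (Finset.notMem_erase i₀ _)).neg_left
  filter_upwards [ae_ne_of_indepFun (hN i₀) (by fun_prop) hrest] with ω hω hzero
  have hsum : ∑ i, M i ω = 0 := by simpa [M, map_sum] using congrArg φ hzero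
  rw [← Finset.add_sum_erase _ _ (Finset.mem_univ i₀), hM₀] at hsum
  exact hω (by simpa using eq_neg_of_add_eq_zero_left hsum)

end AlmostSureNonvanishing

section Periodogram

/-- The discrete Fourier transform of `x` at the `j`-th Fourier frequency, as a linear map in `x`;
with the indexing from `0` the phase of `x ℓ` carries the factor `ℓ + 1`. -/
noncomputable def fourierCoeffLin (d j : ℕ) : (Fin d → ℝ) →ₗ[ℝ] ℂ where
  toFun x := ∑ ℓ : Fin d, (x ℓ : ℂ) *
    Complex.exp (-Complex.I * ((ℓ : ℕ) + 1 : ℂ) * (fourierFreq d j : ℂ))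
  map_add' x y := by simp [add_mul, Finset.sum_add_distrib]
  map_smul' c x := by simp [Finset.mul_sum, mul_assoc]

variable {d : ℕ}

theorem periodogram_eq (x : Fin d → ℝ) (j : ℕ) :
    periodogram x j = (1 / (d : ℝ)) * ‖fourierCoeffLin d j x‖ ^ 2 := rfl

theorem periodogram_nonneg (x : Fin d → ℝ) (j : ℕ) : 0 ≤ periodogram x j := by
  rw [periodogram_eq]
  positivity

theorem continuous_periodogram (j : ℕ) : Continuous fun x : Fin d → ℝ ↦ periodogram x j := by
  unfold periodogram
  fun_prop

theorem periodogram_eq_zero_iff (x : Fin d → ℝ) (j : ℕ) :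
    periodogram x j = 0 ↔ fourierCoeffLin d j x = 0 := by
  rcases Nat.eq_zero_or_pos d with rfl | hd
  · have hzero : fourierCoeffLin 0 j x = 0 := by simp [fourierCoeffLin]
    simp [periodogram_eq, hzero]
  · simp [periodogram_eq, hd.ne']

theorem periodogram_smul (c : ℝ) (x : Fin d → ℝ) (j : ℕ) :
    periodogram (c • x) j = c ^ 2 * periodogram x j := by
  rw [periodogram_eq, periodogram_eq, map_smul, norm_smul, mul_pow, Real.norm_eq_abs, sq_abs]
  ring

theorem periodogram_sub_of_mem_zeroSet {e : Fin d → ℝ} (he : e ∈ zeroSet d) (x : Fin d → ℝ)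
    {j : ℕ} (hj : j ∈ Finset.Icc 1 (numFreq d)) : periodogram (x - e) j = periodogram x j := by
  rw [periodogram_eq, periodogram_eq, map_sub, (periodogram_eq_zero_iff e j).1 (he j hj), sub_zero]

theorem isClosed_zeroSet : IsClosed (zeroSet d) := by
  simp only [zeroSet, Set.ofPred_forall]
  exact isClosed_biInter fun j _ ↦ isClosed_eq (continuous_periodogram j) continuous_const

theorem smul_mem_zeroSet_iff {c : ℝ} (hc : c ≠ 0) (x : Fin d → ℝ) :
    c • x ∈ zeroSet d ↔ x ∈ zeroSet d := by
  simp [zeroSet, periodogram_smul, hc]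

theorem sub_mem_zeroSet_iff {e : Fin d → ℝ} (he : e ∈ zeroSet d) (x : Fin d → ℝ) :
    x - e ∈ zeroSet d ↔ x ∈ zeroSet d :=
  forall₂_congr fun j hj ↦ by rw [periodogram_sub_of_mem_zeroSet he x hj]

theorem sum_periodogram_eq_zero_iff (x : Fin d → ℝ) :
    ∑ m ∈ Finset.Icc 1 (numFreq d), periodogram x m = 0 ↔ x ∈ zeroSet d :=
  Finset.sum_eq_zero_iff_of_nonneg fun _ _ ↦ periodogram_nonneg _ _

theorem fourierCoeffLin_one_eq_zero_of_mem_zeroSet (hd : 3 ≤ d) {x : Fin d → ℝ}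
    (hx : x ∈ zeroSet d) : fourierCoeffLin d 1 x = 0 :=
  (periodogram_eq_zero_iff x 1).1 (hx 1 (by simp only [Finset.mem_Icc, numFreq]; omega))

theorem ae_mul_notMem_zeroSet {Ω : Type*} [MeasurableSpace Ω] {P : Measure Ω} (hd : 3 ≤ d)
    {N : Fin d → Ω → ℝ} (hN : ∀ i, AEMeasurable (N i) P) (hind : iIndepFun N P)
    {a : Fin d → ℝ} {i₀ : Fin d} [NullSingletonClass (P.map (N i₀))] (ha : a i₀ ≠ 0) :
    ∀ᵐ ω ∂P, (fun i ↦ a i * N i ω) ∉ zeroSet d := by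
  set w : Fin d → ℂ := fun i ↦
    a i * Complex.exp (-Complex.I * ((i : ℕ) + 1 : ℂ) * (fourierFreq d 1 : ℂ)) with hw
  have hw₀ : w i₀ ≠ 0 := mul_ne_zero (Complex.ofReal_ne_zero.2 ha) (Complex.exp_ne_zero _)
  filter_upwards [ae_sum_smul_ne_zero hN hind hw₀] with ω hω hmem
  refine hω ?_
  rw [← fourierCoeffLin_one_eq_zero_of_mem_zeroSet hd hmem]
  exact Finset.sum_congr rfl fun i _ ↦ by simp only [hw, Complex.real_smul]; push_cast; ring

end Periodogram

section FisherStatistic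

variable {d : ℕ}

theorem continuous_iSup_periodogram :
    Continuous fun x : Fin d → ℝ ↦ ⨆ j : Finset.Icc 1 (numFreq d), periodogram x (j : ℕ) := by
  rcases isEmpty_or_nonempty (Finset.Icc 1 (numFreq d)) with _ | _
  · simp only [Real.iSup_of_isEmpty]
    exact continuous_const
  · simp only [← Finset.sup'_univ_eq_ciSup]
    exact Continuous.finset_sup'_apply _ fun j _ ↦ continuous_periodogram _

theorem continuous_sum_periodogram :
    Continuous fun x : Fin d → ℝ ↦ ∑ m ∈ Finset.Icc 1 (numFreq d), periodogram x m :=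
  continuous_finsetSum _ fun m _ ↦ continuous_periodogram m

theorem measurable_fisherG : Measurable (fisherG : (Fin d → ℝ) → ℝ) :=
  continuous_iSup_periodogram.measurable.div continuous_sum_periodogram.measurable

theorem continuousOn_fisherG : ContinuousOn (fisherG : (Fin d → ℝ) → ℝ) (zeroSet d)ᶜ :=
  continuous_iSup_periodogram.continuousOn.div continuous_sum_periodogram.continuousOn
    fun x hx h ↦ hx ((sum_periodogram_eq_zero_iff x).1 h)

theorem fisherG_smul {c : ℝ} (hc : c ≠ 0) (x : Fin d → ℝ) : fisherG (c • x) = fisherG x := by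
  simp only [fisherG, periodogram_smul]
  rw [← Real.mul_iSup_of_nonneg (sq_nonneg c), ← Finset.mul_sum]
  exact mul_div_mul_left _ _ (pow_ne_zero 2 hc)

theorem fisherG_sub_of_mem_zeroSet {e : Fin d → ℝ} (he : e ∈ zeroSet d) (x : Fin d → ℝ) :
    fisherG (x - e) = fisherG x := by
  have hper : ∀ j ∈ Finset.Icc 1 (numFreq d), periodogram (x - e) j = periodogram x j :=
    fun j hj ↦ periodogram_sub_of_mem_zeroSet he x hj
  rw [fisherG, fisherG, Finset.sum_congr rfl hper,
    iSup_congr fun j : Finset.Icc 1 (numFreq d) ↦ hper j j.2]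

theorem measurable_fisherF : Measurable (fisherF : (Fin d → ℝ) → ℝ) :=
  measurable_fisherG.indicator isClosed_zeroSet.isOpen_compl.measurableSet

theorem fisherF_of_notMem {x : Fin d → ℝ} (hx : x ∉ zeroSet d) : fisherF x = fisherG x :=
  Set.indicator_of_mem hx _

theorem continuousOn_fisherF : ContinuousOn (fisherF : (Fin d → ℝ) → ℝ) (zeroSet d)ᶜ :=
  continuousOn_fisherG.congr fun _ hx ↦ fisherF_of_notMem hx

theorem fisherF_smul {c : ℝ} (hc : c ≠ 0) (x : Fin d → ℝ) : fisherF (c • x) = fisherF x := by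
  classical
  simp only [fisherF, Set.indicator_apply, Set.mem_compl_iff, smul_mem_zeroSet_iff hc,
    fisherG_smul hc]

theorem fisherF_sub_of_mem_zeroSet {e : Fin d → ℝ} (he : e ∈ zeroSet d) (x : Fin d → ℝ) :
    fisherF (x - e) = fisherF x := by
  classical
  simp only [fisherF, Set.indicator_apply, Set.mem_compl_iff, sub_mem_zeroSet_iff he,
    fisherG_sub_of_mem_zeroSet he]

theorem fisherF_sqrt_smul_blockMean_sub {Ω : Type*} {Y : ℕ → Ω → ℝ} {e : Fin d → ℝ}
    (he : e ∈ zeroSet d) (n : ℕ) (ω : Ω) :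
    fisherF (√((n / d : ℕ) : ℝ) • (blockMean Y d n ω - e)) = fisherF (blockMean Y d n ω) := by
  rcases Nat.eq_zero_or_pos (n / d) with h | h
  · have hzero : blockMean Y d n ω = 0 := by
      ext i
      simp [blockMean, h]
    simp [hzero, h]
  · rw [fisherF_smul (by positivity), fisherF_sub_of_mem_zeroSet he]

end FisherStatistic

section BlockMean

variable {Ω Ω' : Type*} [MeasurableSpace Ω] [MeasurableSpace Ω'] {P : Measure Ω} {P' : Measure Ω'}
  {Y : ℕ → Ω → ℝ} {r d : ℕ}

theorem sqrt_smul_blockMean_sub {Ω : Type*} (Y : ℕ → Ω → ℝ) (e : Fin d → ℝ) (n : ℕ) (ω : Ω) :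
    √((n / d : ℕ) : ℝ) • (blockMean Y d n ω - e) = fun i : Fin d ↦
      (√((n / d : ℕ) : ℝ))⁻¹ * ∑ k ∈ Finset.range (n / d), (Y (i + k * d) ω - e i) := by
  ext i
  simp only [Pi.smul_apply, Pi.sub_apply, smul_eq_mul, blockMean, Finset.sum_sub_distrib,
    Finset.sum_const, Finset.card_range, nsmul_eq_mul]
  rcases Nat.eq_zero_or_pos (n / d) with h | h
  · simp [h]
  · have hsqrt : √((n / d : ℕ) : ℝ) ^ 2 = (n / d : ℕ) := Real.sq_sqrt (Nat.cast_nonneg _)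
    field_simp
    rw [hsqrt]

theorem injective_val_add_mul (d : ℕ) :
    Function.Injective fun z : Fin d × ℕ ↦ (z.1 : ℕ) + z.2 * d := fun z w h ↦ by
  have : NeZero d := ⟨z.1.pos.ne'⟩
  refine Prod.swap_injective ((Nat.divModEquiv d).symm.injective ?_)
  simpa [add_comm] using h

theorem iIndepFun_inv_sqrt_mul_sum_sub (hY : ∀ ℓ, AEMeasurable (Y ℓ) P) (hind : iIndepFun Y P)
    (e : Fin d → ℝ) (n : ℕ) :
    iIndepFun (fun (i : Fin d) ω ↦ (√n)⁻¹ * ∑ k ∈ Finset.range n, (Y (i + k * d) ω - e i)) P := by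
  have hcentred : iIndepFun (fun (z : Fin d × ℕ) ω ↦ Y (z.1 + z.2 * d) ω - e z.1) P :=
    (hind.precomp (injective_val_add_mul d)).comp (fun z x ↦ x - e z.1) fun z ↦ by fun_prop
  exact (iIndepFun_sum_snd (fun z ↦ (hY _).sub_const _) hcentred (Finset.range n)).comp
    (fun _ x ↦ (√n)⁻¹ * x) fun _ ↦ by fun_prop

theorem tendstoInDistribution_sqrt_smul_blockMean_sub [IsProbabilityMeasure P]
    [IsProbabilityMeasure P'] [NeZero r] (hd : d ≠ 0) (hL2 : ∀ ℓ, MemLp (Y ℓ) 2 P)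
    (hind : iIndepFun Y P) (hper : ∀ ℓ, IdentDistrib (Y (ℓ + r)) (Y ℓ) P P)
    {N : Fin d → Ω' → ℝ} (hNind : iIndepFun N P')
    (hNlaw : ∀ i, HasLaw (N i) (gaussianReal 0 1) P') :
    TendstoInDistribution
      (fun (n : ℕ) ω ↦ √((n / d : ℕ) : ℝ) •
        (blockMean Y d n ω - limitMean (fun ℓ ↦ P[Y ℓ]) r d)) atTop
      (fun ω i ↦ √(limitVar P Y r d i) * N i ω) (fun _ ↦ P) P' := by
  set e := limitMean (fun ℓ ↦ P[Y ℓ]) r d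
  have hcoord (i : Fin d) : TendstoInDistribution
      (fun (n : ℕ) ω ↦ (√n)⁻¹ * ∑ k ∈ Finset.range n, (Y (i + k * d) ω - e i)) atTop
      (fun ω ↦ √(limitVar P Y r d i) * N i ω) (fun _ ↦ P) P' := by
    have hperi (k : ℕ) : IdentDistrib (Y (i + (k + r) * d)) (Y (i + k * d)) P P := by
      convert identDistrib_mul_add hper d (i + k * d) using 2
      ring
    exact tendstoInDistribution_inv_sqrt_mul_sum_sub_of_periodic (fun k ↦ hL2 (i + k * d))
      (hind.precomp ((injective_val_add_mul d).comp (Prod.mk_right_injective i))) hperi (hNlaw i)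
  have hjoint := tendstoInDistribution_pi hcoord
    (iIndepFun_inv_sqrt_mul_sum_sub (fun ℓ ↦ (hL2 ℓ).aemeasurable) hind e)
    (hNind.comp (fun i x ↦ √(limitVar P Y r d i) * x) fun i ↦ by fun_prop)
  refine (tendstoInDistribution_comp hjoint (Nat.tendsto_div_const_atTop hd)).congr
    (fun n ↦ ae_of_all _ fun ω ↦ ?_) (ae_of_all _ fun _ ↦ rfl)
  exact (sqrt_smul_blockMean_sub Y e n ω).symm

theorem limitVar_nonneg (i : Fin d) : 0 ≤ limitVar P Y r d i :=
  mul_nonneg (by positivity) (Finset.sum_nonneg fun _ _ ↦ variance_nonneg _ _)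

theorem limitVar_pos [NeZero r] (hvar : ∀ ℓ, 0 < Var[Y ℓ; P]) (i : Fin d) :
    0 < limitVar P Y r d i :=
  mul_pos (by simpa using NeZero.pos r)
    (Finset.sum_pos (fun _ _ ↦ hvar _) ⟨0, Finset.mem_range.2 (NeZero.pos r)⟩)

end BlockMean

section Binary

variable {Ω Ω' : Type*} [MeasurableSpace Ω] [MeasurableSpace Ω'] {P : Measure Ω} {P' : Measure Ω'}
  [IsProbabilityMeasure P] [IsProbabilityMeasure P'] {X : Ω → ℝ} {X' : Ω' → ℝ}

theorem memLp_of_ae_eq_zero_or_one {μ : Measure Ω} [IsFiniteMeasure μ] (hX : AEMeasurable X μ)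
    (h01 : ∀ᵐ ω ∂μ, X ω = 0 ∨ X ω = 1) (q : ENNReal) : MemLp X q μ := by
  refine MemLp.of_bound hX.aestronglyMeasurable 1 ?_
  filter_upwards [h01] with ω hω
  rcases hω with h | h <;> simp [h]

theorem measureReal_eq_zero_of_ae_eq_zero_or_one (hX : AEMeasurable X P)
    (h01 : ∀ᵐ ω ∂P, X ω = 0 ∨ X ω = 1) : P.real {ω | X ω = 0} = 1 - P.real {ω | X ω = 1} := by
  rw [← integral_one_sub_of_ae_eq_zero_or_one hX h01, ← integral_of_ae_eq_zero_or_one hX h01,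
    integral_sub (integrable_const 1) ((memLp_of_ae_eq_zero_or_one hX h01 1).integrable le_rfl)]
  simp

theorem variance_pos_of_ae_eq_zero_or_one (hX : AEMeasurable X P)
    (h01 : ∀ᵐ ω ∂P, X ω = 0 ∨ X ω = 1) (hone : P.real {ω | X ω = 1} ∈ Set.Ioo 0 1) :
    0 < Var[X; P] := by
  rw [variance_of_ae_eq_zero_or_one hX h01, measureReal_eq_zero_of_ae_eq_zero_or_one hX h01]
  exact mul_pos (sub_pos.2 hone.2) hone.1

theorem identDistrib_of_ae_eq_zero_or_one (hX : AEMeasurable X P) (hX' : AEMeasurable X' P')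
    (h01 : ∀ᵐ ω ∂P, X ω = 0 ∨ X ω = 1) (h01' : ∀ᵐ ω ∂P', X' ω = 0 ∨ X' ω = 1)
    (hone : P.real {ω | X ω = 1} = P'.real {ω | X' ω = 1}) : IdentDistrib X X' P P' where
  aemeasurable_fst := hX
  aemeasurable_snd := hX'
  map_eq := by
    have hzero : P.real {ω | X ω = 0} = P'.real {ω | X' ω = 0} := by
      rw [measureReal_eq_zero_of_ae_eq_zero_or_one hX h01, hone,
        measureReal_eq_zero_of_ae_eq_zero_or_one hX' h01']
    rw [(Measure.ae_eq_or_eq_iff_map_eq_dirac_add_dirac hX zero_ne_one).1 h01,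
      (Measure.ae_eq_or_eq_iff_map_eq_dirac_add_dirac hX' zero_ne_one).1 h01']
    congr 2
    · exact (measureReal_eq_measureReal_iff).1 hzero
    · exact (measureReal_eq_measureReal_iff).1 hone

theorem identDistrib_add_of_isPeriodLength {Y : ℕ → Ω → ℝ} {p : ℕ → ℝ} {r : ℕ}
    (hY : ∀ ℓ, AEMeasurable (Y ℓ) P) (h01 : ∀ ℓ, ∀ᵐ ω ∂P, Y ℓ ω = 0 ∨ Y ℓ ω = 1)
    (hp : ∀ ℓ, P.real {ω | Y ℓ ω = 1} = p ℓ) (hr : IsPeriodLength p r) (ℓ : ℕ) :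
    IdentDistrib (Y (ℓ + r)) (Y ℓ) P P :=
  identDistrib_of_ae_eq_zero_or_one (hY _) (hY _) (h01 _) (h01 _)
    (by rw [hp, hp, hr.1.2 ℓ 1, one_mul, add_comm])

end Binary

end BinaryPeriodicity

theorem mainTheorem2_general {Ω Ω' : Type*} [MeasurableSpace Ω] [MeasurableSpace Ω']
    (P : Measure Ω) [IsProbabilityMeasure P] (P' : Measure Ω') [IsProbabilityMeasure P']
    (Y : ℕ → Ω → ℝ) (r d : ℕ) [NeZero r] (hYL2 : ∀ ℓ, MemLp (Y ℓ) 2 P) (hYindep : iIndepFun Y P)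
    (hYper : ∀ ℓ, IdentDistrib (Y (ℓ + r)) (Y ℓ) P P) (hd : 3 ≤ d)
    (he : limitMean (fun ℓ ↦ P[Y ℓ]) r d ∈ zeroSet d)
    (i₀ : Fin d) (hi₀ : limitVar P Y r d i₀ ≠ 0)
    (N : Fin d → Ω' → ℝ) (hNindep : iIndepFun N P')
    (hNlaw : ∀ i, HasLaw (N i) (gaussianReal 0 1) P') :
    (∀ᵐ ω ∂P', (fun i ↦ √(limitVar P Y r d i) * N i ω) ∉ zeroSet d) ∧
    (∀ᵐ ω ∂P', (fun i ↦ √(limitVar P Y r d i) / √(limitVar P Y r d i₀) * N i ω) ∉ zeroSet d) ∧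
    TendstoInDistribution (fun (n : ℕ) ω ↦ fisherF (blockMean Y d n ω)) atTop
      (fun ω ↦ fisherG (fun i ↦ √(limitVar P Y r d i) * N i ω)) (fun _ ↦ P) P' ∧
    IdentDistrib (fun ω ↦ fisherG (fun i ↦ √(limitVar P Y r d i) * N i ω))
      (fun ω ↦ fisherG (fun i ↦ √(limitVar P Y r d i) / √(limitVar P Y r d i₀) * N i ω)) P' P' := by
  have hmeasN (i) : AEMeasurable (N i) P' := (hNlaw i).aemeasurable
  have hatom : NullSingletonClass (P'.map (N i₀)) := by
    rw [(hNlaw i₀).map_eq]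
    exact nullSingletonClass_gaussianReal one_ne_zero
  have hs : √(limitVar P Y r d i₀) ≠ 0 :=
    (Real.sqrt_pos.2 ((limitVar_nonneg i₀).lt_of_ne' hi₀)).ne'
  have hratio (ω) : (fun i ↦ √(limitVar P Y r d i) / √(limitVar P Y r d i₀) * N i ω) =
      (√(limitVar P Y r d i₀))⁻¹ • fun i ↦ √(limitVar P Y r d i) * N i ω := by
    ext i
    simp only [Pi.smul_apply, smul_eq_mul]
    ring
  have hA : ∀ᵐ ω ∂P', (fun i ↦ √(limitVar P Y r d i) * N i ω) ∉ zeroSet d :=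
    ae_mul_notMem_zeroSet hd hmeasN hNindep hs
  simp only [hratio, smul_mem_zeroSet_iff (inv_ne_zero hs), fisherG_smul (inv_ne_zero hs)]
  refine ⟨hA, hA, ?_, IdentDistrib.refl (measurable_fisherG.comp_aemeasurable' (by fun_prop))⟩
  have hclt := tendstoInDistribution_sqrt_smul_blockMean_sub (by omega) hYL2 hYindep hYper
    hNindep hNlaw
  refine (tendstoInDistribution_comp_of_continuousOn hclt measurable_fisherF
    isClosed_zeroSet.isOpen_compl continuousOn_fisherF hA).congr
    (fun n ↦ ae_of_all _ fun ω ↦ fisherF_sqrt_smul_blockMean_sub he n ω) ?_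
  filter_upwards [hA] with ω hω using fisherF_of_notMem hω

theorem mainTheorem2
    {Ω Ω' : Type*} [MeasurableSpace Ω] [MeasurableSpace Ω']
    (P : Measure Ω) [IsProbabilityMeasure P] (P' : Measure Ω') [IsProbabilityMeasure P']
    -- the binary time series
    (Y : ℕ → Ω → ℝ) (p : ℕ → ℝ) (r d : ℕ)
    (hYmeas : ∀ ℓ, Measurable (Y ℓ))
    (hYbin : ∀ ℓ ω, Y ℓ ω = 0 ∨ Y ℓ ω = 1)
    (hYindep : iIndepFun Y P)
    (hp : ∀ ℓ, P.real {ω | Y ℓ ω = 1} = p ℓ)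
    (hp01 : ∀ ℓ, p ℓ ∈ Set.Ioo (0 : ℝ) 1)
    (hr : IsPeriodLength p r)
    (hd : 3 ≤ d)
    -- the vector of limits lies in `A`
    (he : limitMean p r d ∈ zeroSet d)
    -- i.i.d. standard normal random variables
    (N : Fin d → Ω' → ℝ)
    (hNindep : iIndepFun N P')
    (hNlaw : ∀ i, HasLaw (N i) (gaussianReal 0 1) P') :
    -- both limit vectors are almost surely in the domain of `g`
    (∀ᵐ ω ∂P', (fun i => √(limitVar P Y r d i) * N i ω) ∉ zeroSet d) ∧
    (∀ᵐ ω ∂P', (fun i => √(limitVar P Y r d i) / √(limitVar P Y r d ⟨0, by omega⟩) * N i ω)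
      ∉ zeroSet d) ∧
    TendstoInDistribution
      (fun (n : ℕ) ω => fisherF (blockMean Y d n ω)) atTop
      (fun ω => fisherG (fun i => √(limitVar P Y r d i) * N i ω))
      (fun _ => P) P' ∧
    IdentDistrib
      (fun ω => fisherG (fun i => √(limitVar P Y r d i) * N i ω))
      (fun ω => fisherG
        (fun i => √(limitVar P Y r d i) / √(limitVar P Y r d ⟨0, by omega⟩) * N i ω))
      P' P' := by
  have : NeZero r := ⟨hr.1.1.ne'⟩
  have hmeas (ℓ) : AEMeasurable (Y ℓ) P := (hYmeas ℓ).aemeasurable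
  have hbin (ℓ) : ∀ᵐ ω ∂P, Y ℓ ω = 0 ∨ Y ℓ ω = 1 := ae_of_all _ (hYbin ℓ)
  have hmean : (fun ℓ ↦ P[Y ℓ]) = p :=
    funext fun ℓ ↦ (integral_of_ae_eq_zero_or_one (hmeas ℓ) (hbin ℓ)).trans (hp ℓ)
  have hvar (ℓ) : 0 < Var[Y ℓ; P] :=
    variance_pos_of_ae_eq_zero_or_one (hmeas ℓ) (hbin ℓ) (hp ℓ ▸ hp01 ℓ)
  exact mainTheorem2_general P P' Y r d (fun ℓ ↦ memLp_of_ae_eq_zero_or_one (hmeas ℓ) (hbin ℓ) 2)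
    hYindep (identDistrib_add_of_isPeriodLength hmeas hbin hp hr) hd (hmean ▸ he) _
    (limitVar_pos hvar _).ne' N hNindep hNlaw
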